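/- Let $\mathcal H$ be a complex Hilbert space, let $\mathcal L$ be a (possibly unbounded) self-adjoint operator on $\mathcal H$ with domain $\mathcal D(\mathcal L)$, and let $\mathcal E$ be its projection-valued spectral measure, so that $\mathcal L=\int_{\mathbb R} y\,d\mathcal E(y)$. Let $f\in\mathcal H$ with $\|f\|=1$, let $\mu_f(\Omega)=\langle\mathcal E(\Omega)f,f\rangle$ ($\Omega\subset\mathbb R$ Borel) be the spectral measure of $\mathcal L$ with respect to $f$, and let $\rho_f$ be (a version of) the Radon--Nikodym derivative of the absolutely continuous part of $\mu_f$ with respect to Lebesgue measure. For $\epsilon>0$ and $x\in\mathbb R$ put $$\mu_f^\epsilon(x)=\frac1\pi\,\mathrm{Im}\,\big\langle(\mathcal L-x-i\epsilon)^{-1}f,f\big\rangle ,$$ where the inner product is linear in the first argument; the point $x+i\epsilon$ lies in the resolvent set of $\mathcal L$. Let $x_0\in\mathbb R$, $\eta>0$, $0\le\alpha<1$, and $I=(x_0-\eta,x_0+\eta)$. Suppose that $\mu_f$ is absolutely continuous on $I$ and that $\rho_f\in\mathcal C^{0,\alpha}(I)$, that is, $\rho_f$ is continuous on $I$ with $\|\rho_f\|_{\infty,I}=\sup_{x\in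 I}|\rho_f(x)|<\infty$ and $$|\rho_f|_{\mathcal C^{0,\alpha}(I)}=\sup_{x\ne y\in I}\frac{|\rho_f(x)-\rho_f(y)|}{|x-y|^\alpha}<\infty .$$ Then $$|\rho_f(x_0)-\mu_f^\epsilon(x_0)|=\mathcal O(\epsilon^\alpha)\qquad\text{as }\epsilon\downarrow0 .$$ More precisely, there is a universal constant $C\ge 0$ (independent of $\mathcal H,\mathcal L,f,x_0,\eta,\alpha$ and $\epsilon$) such that for all $\epsilon>0$ $$|\rho_f(x_0)-\mu_f^\epsilon(x_0)|\le\Big(|\rho_f|_{\mathcal C^{0,\alpha}(I)}+C\,\eta^{-\alpha}\,\|\rho_f\|_{\infty,I}\Big)\sec\!\Big(\frac{\alpha\pi}{2}\Big)\,\epsilon^\alpha+\frac{\epsilon}{\pi\left(\epsilon^2+\frac{\eta^2}{4}\right)} .$$ -/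

import Mathlib

open MeasureTheory Filter Asymptotics
open scoped Topology ENNReal

universe u

namespace SpectralPoisson

section Operators

variable {H : Type u} [NormedAddCommGroup H] [InnerProductSpace ℂ H] [CompleteSpace H]

/-- `R` is a bounded, everywhere defined, two-sided inverse of `L - z`, where `L` is a possibly
unbounded operator with domain `L.domain`. -/
def IsResolventAt (L : H →ₗ.[ℂ] H) (z : ℂ) (R : H →L[ℂ] H) : Prop :=
  (∀ g : H, ∃ h : R g ∈ L.domain, L ⟨R g, h⟩ - z • R g = g) ∧
    ∀ v : L.domain, R (L v - z • (v : H)) = v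

/-- The resolvent set of `L`, the complement of its spectrum. -/
def resolventSet (L : H →ₗ.[ℂ] H) : Set ℂ := {z | ∃ R : H →L[ℂ] H, IsResolventAt L z R}

open Classical in
/-- The resolvent `(L - z)⁻¹`, for `z` in the resolvent set (where it is uniquely determined);
it is set to `0` elsewhere. -/
noncomputable def resolvent (L : H →ₗ.[ℂ] H) (z : ℂ) : H →L[ℂ] H :=
  if h : z ∈ resolventSet L then h.choose else 0

theorem isResolventAt_resolvent {L : H →ₗ.[ℂ] H} {z : ℂ} (h : z ∈ resolventSet L) :
    IsResolventAt L z (resolvent L z) := by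
  unfold resolvent
  rw [dif_pos h]
  exact h.choose_spec

/-- The Poisson-smoothed spectral measure `x ↦ π⁻¹ Im ⟨(L - x - iε)⁻¹ f, f⟩`. Mathlib's `inner` is
linear in its second argument, so `⟨u, f⟩`, linear in `u`, is `inner ℂ f u`. -/
noncomputable def smoothedMeasure (L : H →ₗ.[ℂ] H) (f : H) (ε x : ℝ) : ℝ :=
  (1 / Real.pi) * (inner ℂ f (resolvent L ((x : ℂ) + (ε : ℂ) * Complex.I) f)).im

variable (H) in
/-- A projection-valued measure on the Borel sets of `ℝ`: it assigns an orthogonal projection to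
each Borel set, is multiplicative on intersections, sends `ℝ` to the identity, and is strongly
countably additive. Values on non-measurable sets play no role. -/
structure ProjectionValuedMeasure where
  /-- the projection attached to a set -/
  proj : Set ℝ → H →L[ℂ] H
  isStarProjection : ∀ s, MeasurableSet s → IsStarProjection (proj s)
  proj_univ : proj Set.univ = 1
  proj_inter : ∀ s t, MeasurableSet s → MeasurableSet t → proj (s ∩ t) = proj s * proj t
  hasSum_iUnion : ∀ s : ℕ → Set ℝ, (∀ n, MeasurableSet (s n)) →
    Pairwise (Function.onFun Disjoint s) →
      ∀ g : H, HasSum (fun n => proj (s n) g) (proj (⋃ n, s n) g)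

namespace ProjectionValuedMeasure

variable (E : ProjectionValuedMeasure H)

theorem inner_proj {s : Set ℝ} (hs : MeasurableSet s) (g : H) :
    inner ℂ g (E.proj s g) = ((‖E.proj s g‖ ^ 2 : ℝ) : ℂ) := by
  have h := E.isStarProjection s hs
  have h1 : E.proj s (E.proj s g) = E.proj s g :=
    DFunLike.congr_fun h.isIdempotentElem g
  have h2 : ContinuousLinearMap.adjoint (E.proj s) = E.proj s := h.isSelfAdjoint
  calc inner ℂ g (E.proj s g) = inner ℂ g (E.proj s (E.proj s g)) := by rw [h1]
    _ = inner ℂ (E.proj s g) (E.proj s g) := by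
        rw [← ContinuousLinearMap.adjoint_inner_left, h2]
    _ = _ := by rw [inner_self_eq_norm_sq_to_K]; norm_cast

theorem proj_empty_apply (g : H) : E.proj ∅ g = 0 := by
  have h := E.hasSum_iUnion (fun _ => ∅) (fun _ => MeasurableSet.empty)
    (fun _ _ _ => disjoint_bot_left) g
  have h' := h.summable.tendsto_atTop_zero
  exact tendsto_nhds_unique tendsto_const_nhds h'

/-- The scalar spectral measure `s ↦ ⟨E(s) f, f⟩` (a non-negative real number for Borel `s`). -/
noncomputable def scalarMeasure (f : H) : Measure ℝ :=
  Measure.ofMeasurable (fun s _ => ENNReal.ofReal (inner ℂ f (E.proj s f)).re)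
    (by simp [proj_empty_apply])
    (by
      intro s hs hd
      have h := E.hasSum_iUnion s hs hd f
      have h1 : HasSum (fun n => (inner ℂ f (E.proj (s n) f)).re)
          (inner ℂ f (E.proj (⋃ n, s n) f)).re :=
        (h.mapL (innerSL ℂ f)).mapL Complex.reCLM
      have h0 : ∀ n, 0 ≤ (inner ℂ f (E.proj (s n) f)).re := by
        intro n
        rw [E.inner_proj (hs n), Complex.ofReal_re]
        positivity
      rw [← h1.tsum_eq, ENNReal.ofReal_tsum_of_nonneg h0 h1.summable])

theorem scalarMeasure_apply (f : H) {s : Set ℝ} (hs : MeasurableSet s) :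
    E.scalarMeasure f s = ENNReal.ofReal (inner ℂ f (E.proj s f)).re :=
  Measure.ofMeasurable_apply s hs

/-- `E` is the projection-valued measure of the operator `L`, i.e. `L = ∫ y dE(y)`: the domain of
`L` is `{v | ∫ y² d⟨E(y)v, v⟩ < ∞}`, and `⟨L v, v⟩ = ∫ y d⟨E(y)v, v⟩` for `v` in that domain (which
determines `L` by polarization, the domain being dense). -/
def IsSpectralMeasureOf (E : ProjectionValuedMeasure H) (L : H →ₗ.[ℂ] H) : Prop :=
  (∀ v : H, v ∈ L.domain ↔ Integrable (fun y : ℝ => y ^ 2) (E.scalarMeasure v)) ∧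
    ∀ v : L.domain,
      inner ℂ (v : H) (L v) = ((∫ y, y ∂(E.scalarMeasure (v : H)) : ℝ) : ℂ)

end ProjectionValuedMeasure

end Operators

/-- The set of Hölder quotients of `h` on `I`. -/
def holderQuotients (α : ℝ) (I : Set ℝ) (h : ℝ → ℝ) : Set ℝ :=
  {r | ∃ x ∈ I, ∃ y ∈ I, x ≠ y ∧ r = |h x - h y| / |x - y| ^ α}

/-- Membership of (the restriction to `I` of) `h` in the Hölder space `C^{0,α}(I)`: continuity on
`I`, finite supremum norm and finite Hölder seminorm. -/
structure MemHolder (α : ℝ) (I : Set ℝ) (h : ℝ → ℝ) : Prop where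
  continuousOn : ContinuousOn h I
  bddAbove_abs : BddAbove ((fun x => |h x|) '' I)
  bddAbove_quotients : BddAbove (holderQuotients α I h)

/-- The Hölder seminorm `|h|_{C^{0,α}(I)}`. -/
noncomputable def holderSeminorm (α : ℝ) (I : Set ℝ) (h : ℝ → ℝ) : ℝ :=
  sSup (holderQuotients α I h)

/-- The supremum norm `‖h‖_{∞,I}`. -/
noncomputable def supNorm (I : Set ℝ) (h : ℝ → ℝ) : ℝ := sSup ((fun x => |h x|) '' I)

end SpectralPoisson

/-!
The resolvent at `z = x₀ + iε` produces `g = (L - z)⁻¹ f`, and `π⁻¹ Im ⟨g, f⟩ = π⁻¹ ε ‖g‖²`. The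
relation between `L` and its spectral measure `E` is only given through quadratic forms, so it has
to be shown that the measure `⟨E(·) f, f⟩` is `(y - x₀)² + ε²` times `⟨E(·) g, g⟩`. Polarization of
the quadratic form of `L` over disjoint sets shows that `L` commutes with the spectral projections
(`map_proj`). A second polarization, at `w ± (L - x) w`, gives `‖(L - x) w‖² = ∫ (y - x)² d⟨E w, w⟩`
for `w` over a bounded set, and by exhaustion on the whole domain (`scalarMeasure_map_sub`). Taking
total masses, `smoothedMeasure_eq_integral` identifies the smoothed spectral measure with the
Poisson integral of `⟨E(·) f, f⟩`.

That `z` lies in the resolvent set is the usual argument: `L - z` is bounded below by `ε`, has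
closed range because `L` is closed, and dense range because `L` equals its adjoint.

What remains is an estimate for the Poisson integral of a probability measure `μ` with density `ρ`
near `x₀` (`abs_sub_integral_poissonKernel_le`). On `|y - x₀| < η / 2` the Hölder bound is
integrated against the kernel, whose absolute moment of order `α` is exactly `sec (απ/2) ε ^ α`;
this value comes from the reflection formula for the Gamma function. Outside, the mass of
the kernel is controlled by the same moment through Markov's inequality, which yields the
constant `C = 2`, and the contribution of `μ` is at most the supremum of the kernel there, as `μ` has total mass `1`.
-/

namespace SpectralPoisson

/-! ### Moments of the Poisson kernel -/

theorem cos_pos_of_lt_one {α : ℝ} (hα₀ : 0 ≤ α) (hα₁ : α < 1) :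
    0 < Real.cos (α * Real.pi / 2) := by
  apply Real.cos_pos_of_mem_Ioo
  constructor <;> nlinarith [Real.pi_pos]

theorem integral_Ioi_exp_neg_mul {b : ℝ} (hb : 0 < b) :
    ∫ s in Set.Ioi (0 : ℝ), Real.exp (-b * s) = b⁻¹ := by
  rw [integral_exp_mul_Ioi (neg_lt_zero.2 hb)]
  simp

/-- The Mellin transform of `(1 + t²)⁻¹`. Writing `(1 + t²)⁻¹ = ∫ exp (-(1 + t²) s) ds` and
exchanging the integrals turns it into a product of Gamma values, which the reflection formula
evaluates. -/
theorem integral_Ioi_rpow_mul_inv_one_add_sq {α : ℝ} (hα₀ : 0 ≤ α) (hα₁ : α < 1) :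
    ∫ t in Set.Ioi (0 : ℝ), t ^ α * (1 + t ^ 2)⁻¹
      = Real.pi / 2 * (Real.cos (α * Real.pi / 2))⁻¹ := by
  have hpos : ∀ t : ℝ, 0 < 1 + t ^ 2 := fun t => by positivity
  -- Each integral below has a nonzero value, hence its integrand is integrable, a
  -- nonintegrable function having Bochner integral `0`.
  -- The first of them is the inner integral in `s`.
  have hs : ∀ t ∈ Set.Ioi (0 : ℝ), ENNReal.ofReal (t ^ α * (1 + t ^ 2)⁻¹)
      = ∫⁻ s in Set.Ioi (0 : ℝ), ENNReal.ofReal (t ^ α * Real.exp (-(1 + t ^ 2) * s)) := by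
    intro t ht
    have hval : ∫ s in Set.Ioi (0 : ℝ), t ^ α * Real.exp (-(1 + t ^ 2) * s)
        = t ^ α * (1 + t ^ 2)⁻¹ := by
      rw [integral_const_mul, integral_Ioi_exp_neg_mul (hpos t)]
    have htα : 0 < t ^ α := Real.rpow_pos_of_pos ht _
    have hint : Integrable (fun s => t ^ α * Real.exp (-(1 + t ^ 2) * s))
        (volume.restrict (Set.Ioi (0 : ℝ))) := by
      by_contra h
      rw [integral_undef h] at hval
      have := mul_pos htα (inv_pos.2 (hpos t))
      linarith
    rw [← hval, ofReal_integral_eq_lintegral_ofReal hint (ae_of_all _ fun s => by positivity)]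
  -- the inner integral in `t`
  have ht : ∀ s ∈ Set.Ioi (0 : ℝ),
      ∫⁻ t in Set.Ioi (0 : ℝ), ENNReal.ofReal (t ^ α * Real.exp (-(1 + t ^ 2) * s))
      = ENNReal.ofReal (Real.Gamma ((α + 1) / 2) / 2
          * (Real.exp (-s) * s ^ ((1 - (α + 1) / 2) - 1))) := by
    intro s hs0
    have hs0 : 0 < s := hs0
    have hval : ∫ t in Set.Ioi (0 : ℝ), t ^ α * Real.exp (-(1 + t ^ 2) * s)
        = Real.Gamma ((α + 1) / 2) / 2 * (Real.exp (-s) * s ^ ((1 - (α + 1) / 2) - 1)) := by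
      have h1 := integral_rpow_mul_exp_neg_mul_rpow (p := 2) (q := α) two_pos (by linarith) hs0
      have h2 : ∀ t : ℝ, t ^ α * Real.exp (-(1 + t ^ 2) * s)
          = Real.exp (-s) * (t ^ α * Real.exp (-s * t ^ (2 : ℝ))) := fun t => by
        rw [Real.rpow_two, mul_left_comm, ← Real.exp_add]
        congr 2; ring
      simp only [h2]
      rw [integral_const_mul, h1, show -(α + 1) / 2 = (1 - (α + 1) / 2) - 1 by ring]
      ring
    have hG : 0 < Real.Gamma ((α + 1) / 2) := Real.Gamma_pos_of_pos (by linarith)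
    have hp : 0 < Real.Gamma ((α + 1) / 2) / 2
        * (Real.exp (-s) * s ^ ((1 - (α + 1) / 2) - 1)) := by positivity
    have hint : Integrable (fun t => t ^ α * Real.exp (-(1 + t ^ 2) * s))
        (volume.restrict (Set.Ioi (0 : ℝ))) := by
      by_contra h
      rw [integral_undef h] at hval
      linarith
    rw [← hval, ofReal_integral_eq_lintegral_ofReal hint]
    filter_upwards [ae_restrict_mem measurableSet_Ioi] with t ht
    exact mul_nonneg (Real.rpow_nonneg (le_of_lt ht) _) (Real.exp_pos _).le
  have hcos : 0 < Real.cos (α * Real.pi / 2) := cos_pos_of_lt_one hα₀ hα₁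
  have hG : ∫ s in Set.Ioi (0 : ℝ), Real.Gamma ((α + 1) / 2) / 2
          * (Real.exp (-s) * s ^ ((1 - (α + 1) / 2) - 1))
      = Real.pi / 2 * (Real.cos (α * Real.pi / 2))⁻¹ := by
    rw [integral_const_mul, ← Real.Gamma_eq_integral (by linarith), div_mul_eq_mul_div,
      Real.Gamma_mul_Gamma_one_sub,
      show Real.pi * ((α + 1) / 2) = α * Real.pi / 2 + Real.pi / 2 by ring,
      Real.sin_add_pi_div_two]
    ring
  have hGpos : 0 < Real.pi / 2 * (Real.cos (α * Real.pi / 2))⁻¹ := by positivity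
  have hGint : Integrable (fun s => Real.Gamma ((α + 1) / 2) / 2
      * (Real.exp (-s) * s ^ ((1 - (α + 1) / 2) - 1))) (volume.restrict (Set.Ioi (0 : ℝ))) := by
    by_contra h
    rw [integral_undef h] at hG
    linarith
  rw [integral_eq_lintegral_of_nonneg_ae, setLIntegral_congr_fun measurableSet_Ioi hs,
    lintegral_lintegral_swap, setLIntegral_congr_fun measurableSet_Ioi ht,
    ← ofReal_integral_eq_lintegral_ofReal hGint, hG, ENNReal.toReal_ofReal hGpos.le]
  · filter_upwards [ae_restrict_mem measurableSet_Ioi] with s hs0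
    have hs0 : 0 < s := hs0
    have : 0 < Real.Gamma ((α + 1) / 2) := Real.Gamma_pos_of_pos (by linarith)
    simp only [Pi.zero_apply]
    positivity
  · exact Measurable.aemeasurable (by unfold Function.uncurry; fun_prop)
  · filter_upwards [ae_restrict_mem measurableSet_Ioi] with t ht0
    exact mul_nonneg (Real.rpow_nonneg (le_of_lt ht0) _) (inv_pos.2 (hpos t)).le
  · exact Measurable.aestronglyMeasurable (by fun_prop)

/-- The Poisson kernel of height `ε` centred at `x`. -/
noncomputable def poissonKernel (x ε y : ℝ) : ℝ := Real.pi⁻¹ * ε * ((y - x) ^ 2 + ε ^ 2)⁻¹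

theorem poissonKernel_nonneg {ε : ℝ} (hε : 0 < ε) (x y : ℝ) : 0 ≤ poissonKernel x ε y := by
  unfold poissonKernel; positivity

theorem continuous_poissonKernel {ε : ℝ} (hε : 0 < ε) (x : ℝ) :
    Continuous (poissonKernel x ε) := by
  unfold poissonKernel
  exact continuous_const.mul (Continuous.inv₀ (by fun_prop) fun y => by positivity)

theorem integral_poissonKernel {ε : ℝ} (hε : 0 < ε) (x : ℝ) : ∫ y, poissonKernel x ε y = 1 :=
  ProbabilityTheory.integral_cauchyPDFReal_eq_one x (γ := ⟨ε, hε.le⟩)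
    (fun h => hε.ne' (congrArg NNReal.toReal h))

theorem integrable_poissonKernel {ε : ℝ} (hε : 0 < ε) (x : ℝ) :
    Integrable (poissonKernel x ε) :=
  ProbabilityTheory.integrable_cauchyPDFReal x (γ := ⟨ε, hε.le⟩)

/-- The absolute moment of order `α` of the Poisson kernel. -/
theorem integral_poissonKernel_mul_rpow {α ε : ℝ} (hα₀ : 0 ≤ α) (hα₁ : α < 1) (hε : 0 < ε)
    (x : ℝ) :
    ∫ y, poissonKernel x ε y * |y - x| ^ α = (Real.cos (α * Real.pi / 2))⁻¹ * ε ^ α := by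
  have h0 : ∫ t : ℝ, |t| ^ α * (1 + |t| ^ 2)⁻¹
      = 2 * (Real.pi / 2 * (Real.cos (α * Real.pi / 2))⁻¹) := by
    rw [← integral_Ioi_rpow_mul_inv_one_add_sq hα₀ hα₁]
    exact integral_comp_abs (f := fun t => t ^ α * (1 + t ^ 2)⁻¹)
  have h1 := Measure.integral_comp_mul_left (fun t : ℝ => |t| ^ α * (1 + |t| ^ 2)⁻¹) ε⁻¹
  have h2 := integral_sub_right_eq_self (μ := (volume : Measure ℝ))
    (fun t : ℝ => |ε⁻¹ * t| ^ α * (1 + |ε⁻¹ * t| ^ 2)⁻¹) x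
  have h3 : ∀ y : ℝ, poissonKernel x ε y * |y - x| ^ α
      = (Real.pi⁻¹ * ε⁻¹ * ε ^ α) *
        (|ε⁻¹ * (y - x)| ^ α * (1 + |ε⁻¹ * (y - x)| ^ 2)⁻¹) := fun y => by
    rw [abs_mul, abs_of_pos (inv_pos.2 hε), Real.mul_rpow (inv_pos.2 hε).le (abs_nonneg _),
      Real.inv_rpow hε.le, mul_pow, sq_abs, poissonKernel]
    have : 0 < ε ^ α := Real.rpow_pos_of_pos hε _
    field_simp
    ring
  simp only [h3]
  rw [integral_const_mul, h2, h1, h0, inv_inv, abs_of_pos hε, smul_eq_mul]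
  field_simp

/-- The integral just computed is nonzero, whereas it would be `0` without integrability. -/
theorem integrable_poissonKernel_mul_rpow {α ε : ℝ} (hα₀ : 0 ≤ α) (hα₁ : α < 1) (hε : 0 < ε)
    (x : ℝ) : Integrable fun y => poissonKernel x ε y * |y - x| ^ α := by
  by_contra h
  have h1 := integral_poissonKernel_mul_rpow hα₀ hα₁ hε x
  rw [integral_undef h] at h1
  have := cos_pos_of_lt_one hα₀ hα₁
  have : 0 < (Real.cos (α * Real.pi / 2))⁻¹ * ε ^ α := by positivity
  linarith

/-- The mass of the Poisson kernel away from its centre is bounded through its moment of order `α`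
by Markov's inequality; this gives the factor `ε ^ α` for all `ε` at once. -/
theorem setIntegral_poissonKernel_le {α ε r : ℝ} (hα₀ : 0 ≤ α) (hα₁ : α < 1) (hε : 0 < ε)
    (hr : 0 < r) (x : ℝ) :
    ∫ y in (Set.Ioo (x - r) (x + r))ᶜ, poissonKernel x ε y
      ≤ r ^ (-α) * ((Real.cos (α * Real.pi / 2))⁻¹ * ε ^ α) := by
  have hi := (integrable_poissonKernel_mul_rpow hα₀ hα₁ hε x).const_mul (r ^ (-α))
  calc ∫ y in (Set.Ioo (x - r) (x + r))ᶜ, poissonKernel x ε y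
      ≤ ∫ y in (Set.Ioo (x - r) (x + r))ᶜ, r ^ (-α) * (poissonKernel x ε y * |y - x| ^ α) := by
        refine setIntegral_mono_on (integrable_poissonKernel hε x).integrableOn hi.integrableOn
          measurableSet_Ioo.compl fun y hy => ?_
        have hy' : r ≤ |y - x| := by
          by_contra hlt
          rw [not_le, abs_lt] at hlt
          exact hy ⟨by linarith, by linarith⟩
        have h1 : r ^ α ≤ |y - x| ^ α := Real.rpow_le_rpow hr.le hy' hα₀
        have h2 : 0 < r ^ α := Real.rpow_pos_of_pos hr _
        have h3 : 1 ≤ r ^ (-α) * |y - x| ^ α := by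
          rw [Real.rpow_neg hr.le, inv_mul_eq_div, one_le_div h2]; exact h1
        have := mul_le_mul_of_nonneg_left h3 (poissonKernel_nonneg hε x y)
        linarith
    _ ≤ ∫ y, r ^ (-α) * (poissonKernel x ε y * |y - x| ^ α) :=
        setIntegral_le_integral hi (ae_of_all _ fun y => by
          have := poissonKernel_nonneg hε x y
          simp only [Pi.zero_apply]
          positivity)
    _ = _ := by rw [integral_const_mul, integral_poissonKernel_mul_rpow hα₀ hα₁ hε x]

/-! ### Poisson integrals of measures with a Hölder continuous density -/

theorem holderSeminorm_nonneg (α : ℝ) (I : Set ℝ) (h : ℝ → ℝ) : 0 ≤ holderSeminorm α I h := by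
  refine Real.sSup_nonneg ?_
  rintro r ⟨x, -, y, -, -, rfl⟩
  positivity

namespace MemHolder

variable {α : ℝ} {I : Set ℝ} {h : ℝ → ℝ}

theorem abs_le_supNorm (hh : MemHolder α I h) {x : ℝ} (hx : x ∈ I) : |h x| ≤ supNorm I h :=
  le_csSup hh.bddAbove_abs ⟨x, hx, rfl⟩

theorem abs_sub_le (hh : MemHolder α I h) {x y : ℝ} (hx : x ∈ I) (hy : y ∈ I) :
    |h x - h y| ≤ holderSeminorm α I h * |y - x| ^ α := by
  rcases eq_or_ne x y with rfl | hxy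
  · rw [sub_self, abs_zero]
    exact mul_nonneg (holderSeminorm_nonneg α I h) (Real.rpow_nonneg (abs_nonneg _) _)
  · have h1 : |h x - h y| / |x - y| ^ α ≤ holderSeminorm α I h :=
      le_csSup hh.bddAbove_quotients ⟨x, hx, y, hy, hxy, rfl⟩
    have h2 : 0 < |x - y| ^ α := Real.rpow_pos_of_pos (abs_pos.2 (sub_ne_zero.2 hxy)) _
    rw [div_le_iff₀ h2] at h1
    rwa [abs_sub_comm y x]

end MemHolder

/-- On a set where `μ` is absolutely continuous, integrals against `μ` are integrals against any
version of the density. -/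
theorem setIntegral_eq_setIntegral_density {μ : Measure ℝ} [IsFiniteMeasure μ] {ρ : ℝ → ℝ}
    (hρ : ρ =ᵐ[volume] fun y => (μ.rnDeriv volume y).toReal) {J : Set ℝ} (hJ : MeasurableSet J)
    (hac : μ.restrict J ≪ volume) (k : ℝ → ℝ) :
    ∫ y in J, k y ∂μ = ∫ y in J, k y * ρ y := by
  rw [← integral_rnDeriv_smul hac, ← integral_indicator hJ]
  refine integral_congr_ae ?_
  filter_upwards [hρ, Measure.rnDeriv_restrict μ volume hJ] with y h1 h2
  rw [h2]
  by_cases hy : y ∈ J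
  · rw [Set.indicator_of_mem hy, Set.indicator_of_mem hy, h1, smul_eq_mul, mul_comm]
  · rw [Set.indicator_of_notMem hy, Set.indicator_of_notMem hy]; simp

/-- The quantitative estimate for the Poisson integral of a probability measure with a Hölder
continuous density near `x₀`. The interval is cut at distance `η / 2` from `x₀`; inside, the Hölder
bound is integrated against the kernel, and outside the kernel is small. -/
theorem abs_sub_integral_poissonKernel_le {μ : Measure ℝ} [IsProbabilityMeasure μ] {ρ : ℝ → ℝ}
    (hρ : ρ =ᵐ[volume] fun y => (μ.rnDeriv volume y).toReal) {x₀ η α ε : ℝ} (hη : 0 < η)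
    (hα₀ : 0 ≤ α) (hα₁ : α < 1) (hac : μ.restrict (Set.Ioo (x₀ - η) (x₀ + η)) ≪ volume)
    (hh : MemHolder α (Set.Ioo (x₀ - η) (x₀ + η)) ρ) (hε : 0 < ε) :
    |ρ x₀ - ∫ y, poissonKernel x₀ ε y ∂μ| ≤
      (holderSeminorm α (Set.Ioo (x₀ - η) (x₀ + η)) ρ
          + 2 * η ^ (-α) * supNorm (Set.Ioo (x₀ - η) (x₀ + η)) ρ)
        * (Real.cos (α * Real.pi / 2))⁻¹ * ε ^ α
      + ε / (Real.pi * (ε ^ 2 + η ^ 2 / 4)) := by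
  set I := Set.Ioo (x₀ - η) (x₀ + η) with hI
  set J := Set.Ioo (x₀ - η / 2) (x₀ + η / 2) with hJ
  set S := holderSeminorm α I ρ
  set M := supNorm I ρ
  have hJI : J ⊆ I := Set.Ioo_subset_Ioo (by linarith) (by linarith)
  have hx₀ : x₀ ∈ I := ⟨by linarith, by linarith⟩
  have hJm : MeasurableSet J := measurableSet_Ioo
  have hK0 := poissonKernel_nonneg hε x₀
  have hKi := integrable_poissonKernel hε x₀
  have hmi := integrable_poissonKernel_mul_rpow hα₀ hα₁ hε x₀
  have hm := integral_poissonKernel_mul_rpow hα₀ hα₁ hε x₀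
  have hS : 0 ≤ S := holderSeminorm_nonneg α I ρ
  have hc := cos_pos_of_lt_one hα₀ hα₁
  have hKle : ∀ y, poissonKernel x₀ ε y ≤ Real.pi⁻¹ * ε * (ε ^ 2)⁻¹ := fun y => by
    unfold poissonKernel
    gcongr
    nlinarith [sq_nonneg (y - x₀)]
  have hKμ : Integrable (poissonKernel x₀ ε) μ :=
    (integrable_const (Real.pi⁻¹ * ε * (ε ^ 2)⁻¹)).mono'
      (continuous_poissonKernel hε x₀).aestronglyMeasurable
      (ae_of_all _ fun y => by rw [Real.norm_of_nonneg (hK0 y)]; exact hKle y)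
  -- the part near `x₀`
  have hbound : ∀ᵐ y ∂(volume.restrict J), ‖poissonKernel x₀ ε y * (ρ x₀ - ρ y)‖
      ≤ S * (poissonKernel x₀ ε y * |y - x₀| ^ α) := by
    filter_upwards [ae_restrict_mem hJm] with y hy
    rw [norm_mul, Real.norm_of_nonneg (hK0 y), Real.norm_eq_abs]
    have := mul_le_mul_of_nonneg_left (hh.abs_sub_le hx₀ (hJI hy)) (hK0 y)
    linarith
  have hDi : IntegrableOn (fun y => poissonKernel x₀ ε y * (ρ x₀ - ρ y)) J := by
    refine (hmi.const_mul S).integrableOn.mono' ?_ hbound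
    exact ((continuous_poissonKernel hε x₀).continuousOn.mul
      (continuousOn_const.sub (hh.continuousOn.mono hJI))).aestronglyMeasurable hJm
  have hnear : |∫ y in J, poissonKernel x₀ ε y * (ρ x₀ - ρ y)|
      ≤ S * ((Real.cos (α * Real.pi / 2))⁻¹ * ε ^ α) := by
    rw [← Real.norm_eq_abs]
    refine (norm_integral_le_of_norm_le (hmi.const_mul S).integrableOn hbound).trans ?_
    rw [integral_const_mul, ← hm]
    refine mul_le_mul_of_nonneg_left (setIntegral_le_integral hmi (ae_of_all _ fun y => ?_)) hS
    exact mul_nonneg (hK0 y) (Real.rpow_nonneg (abs_nonneg _) _)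
  have hdens : ∫ y in J, poissonKernel x₀ ε y ∂μ
      = ρ x₀ * (∫ y in J, poissonKernel x₀ ε y)
        - ∫ y in J, poissonKernel x₀ ε y * (ρ x₀ - ρ y) := by
    rw [setIntegral_eq_setIntegral_density hρ hJm
      ((Measure.restrict_mono_set μ hJI).absolutelyContinuous.trans hac),
      ← integral_const_mul, ← integral_sub (hKi.integrableOn.const_mul _) hDi]
    exact integral_congr_ae (ae_of_all _ fun y => by ring)
  -- the tail of the kernel
  have htail : ∫ y in Jᶜ, poissonKernel x₀ ε y
      ≤ 2 * η ^ (-α) * ((Real.cos (α * Real.pi / 2))⁻¹ * ε ^ α) := by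
    refine (setIntegral_poissonKernel_le hα₀ hα₁ hε (half_pos hη) x₀).trans ?_
    refine mul_le_mul_of_nonneg_right ?_ (by positivity)
    -- `(η / 2) ^ (-α) = 2 ^ α * η ^ (-α)`, and `2 ^ α ≤ 2`: this is the universal constant
    rw [Real.div_rpow hη.le two_pos.le, Real.rpow_neg two_pos.le, div_inv_eq_mul, mul_comm]
    refine mul_le_mul_of_nonneg_right ?_ (by positivity)
    calc (2 : ℝ) ^ α ≤ 2 ^ (1 : ℝ) := Real.rpow_le_rpow_of_exponent_le one_le_two hα₁.le
      _ = 2 := Real.rpow_one 2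
  have htail0 : 0 ≤ ∫ y in Jᶜ, poissonKernel x₀ ε y := integral_nonneg hK0
  -- the part of the measure far from `x₀`
  have hfar : ∫ y in Jᶜ, poissonKernel x₀ ε y ∂μ ≤ ε / (Real.pi * (ε ^ 2 + η ^ 2 / 4)) := by
    have h1 : ∀ y ∈ Jᶜ, poissonKernel x₀ ε y ≤ ε / (Real.pi * (ε ^ 2 + η ^ 2 / 4)) := by
      intro y hy
      have hy' : η / 2 ≤ |y - x₀| := by
        by_contra hlt
        rw [not_le, abs_lt] at hlt
        exact hy ⟨by linarith, by linarith⟩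
      have h2 : η ^ 2 / 4 ≤ (y - x₀) ^ 2 := by
        rw [← sq_abs (y - x₀)]; nlinarith
      have h3 : ε / (Real.pi * (ε ^ 2 + η ^ 2 / 4)) = Real.pi⁻¹ * ε * (η ^ 2 / 4 + ε ^ 2)⁻¹ := by
        rw [div_eq_mul_inv, mul_inv, add_comm]; ring
      rw [h3, poissonKernel]
      gcongr
    calc ∫ y in Jᶜ, poissonKernel x₀ ε y ∂μ
        ≤ ∫ _y in Jᶜ, ε / (Real.pi * (ε ^ 2 + η ^ 2 / 4)) ∂μ :=
          setIntegral_mono_on hKμ.integrableOn (integrable_const _).integrableOn hJm.compl h1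
      _ = μ.real Jᶜ * (ε / (Real.pi * (ε ^ 2 + η ^ 2 / 4))) := by
          rw [setIntegral_const, smul_eq_mul]
      _ ≤ 1 * (ε / (Real.pi * (ε ^ 2 + η ^ 2 / 4))) :=
          mul_le_mul_of_nonneg_right measureReal_le_one (by positivity)
      _ = _ := one_mul _
  have hfar0 : 0 ≤ ∫ y in Jᶜ, poissonKernel x₀ ε y ∂μ := integral_nonneg hK0
  have hsplit : ρ x₀ - ∫ y, poissonKernel x₀ ε y ∂μ
      = (∫ y in J, poissonKernel x₀ ε y * (ρ x₀ - ρ y))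
        + ρ x₀ * (∫ y in Jᶜ, poissonKernel x₀ ε y) - ∫ y in Jᶜ, poissonKernel x₀ ε y ∂μ := by
    have h1 := integral_add_compl hJm hKi
    have h2 := integral_add_compl hJm hKμ
    rw [integral_poissonKernel hε x₀] at h1
    linear_combination h2 - hdens - ρ x₀ * h1
  have hprod : |ρ x₀ * ∫ y in Jᶜ, poissonKernel x₀ ε y|
      ≤ M * (2 * η ^ (-α) * ((Real.cos (α * Real.pi / 2))⁻¹ * ε ^ α)) := by
    rw [abs_mul, abs_of_nonneg htail0]
    have h1 : |ρ x₀| ≤ M := hh.abs_le_supNorm hx₀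
    exact mul_le_mul h1 htail htail0 ((abs_nonneg _).trans h1)
  rw [hsplit]
  refine (abs_sub _ _).trans ((add_le_add (abs_add_le _ _) le_rfl).trans ?_)
  rw [abs_of_nonneg hfar0]
  linarith

/-! ### Integrals against a difference of measures -/

/-- If the difference of two finite measures has density `φ` with respect to a third measure, then
integrals against that difference are computed with this density. Moving the negative part `q` of
`φ` to the other side turns the hypothesis into an equality of positive measures. -/
theorem integral_sub_integral_of_forall_setIntegral {m₁ m₂ m : Measure ℝ} [IsFiniteMeasure m₁]
    [IsFiniteMeasure m₂] [IsFiniteMeasure m] {φ ψ : ℝ → ℝ} (hφm : Measurable φ)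
    (hψm : Measurable ψ) (hφ : Integrable φ m)
    (h : ∀ s, MeasurableSet s → m₁.real s - m₂.real s = ∫ y in s, φ y ∂m)
    (h₁ : Integrable ψ m₁) (h₂ : Integrable ψ m₂) (hψ : Integrable (fun y => φ y * ψ y) m) :
    ∫ y, ψ y ∂m₁ - ∫ y, ψ y ∂m₂ = ∫ y, φ y * ψ y ∂m := by
  set p : ℝ → ℝ := fun y => max (φ y) 0 with hp
  set q : ℝ → ℝ := fun y => max (-φ y) 0 with hq
  have hpq : ∀ y, φ y = p y - q y := fun y => by
    simp only [hp, hq]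
    rcases le_total 0 (φ y) with h | h
    · rw [max_eq_left h, max_eq_right (by linarith)]; ring
    · rw [max_eq_right h, max_eq_left (by linarith)]; ring
  have hpm : Measurable p := hφm.max measurable_const
  have hqm : Measurable q := hφm.neg.max measurable_const
  have hp0 : ∀ y, 0 ≤ p y := fun y => le_max_right _ _
  have hq0 : ∀ y, 0 ≤ q y := fun y => le_max_right _ _
  have hpi : Integrable p m := hφ.pos_part
  have hqi : Integrable q m := hφ.neg_part
  have hple : ∀ y, |p y * ψ y| ≤ |φ y * ψ y| := fun y => by
    rw [abs_mul, abs_mul]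
    refine mul_le_mul_of_nonneg_right ?_ (abs_nonneg _)
    rw [abs_of_nonneg (hp0 y)]; exact max_le (le_abs_self _) (abs_nonneg _)
  have hqle : ∀ y, |q y * ψ y| ≤ |φ y * ψ y| := fun y => by
    rw [abs_mul, abs_mul]
    refine mul_le_mul_of_nonneg_right ?_ (abs_nonneg _)
    rw [abs_of_nonneg (hq0 y)]; exact max_le (neg_le_abs _) (abs_nonneg _)
  have hpψ : Integrable (fun y => p y * ψ y) m :=
    hψ.mono (hpm.mul hψm).aestronglyMeasurable (ae_of_all _ hple)
  have hqψ : Integrable (fun y => q y * ψ y) m :=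
    hψ.mono (hqm.mul hψm).aestronglyMeasurable (ae_of_all _ hqle)
  have key : m₁ + m.withDensity (fun y => (q y).toNNReal)
      = m₂ + m.withDensity (fun y => (p y).toNNReal) := by
    ext s hs
    have h1 : ∀ r : ℝ → ℝ, (∀ y, 0 ≤ r y) → Integrable r m →
        m.withDensity (fun y => (r y).toNNReal) s = ENNReal.ofReal (∫ y in s, r y ∂m) :=
      fun r hr hri => by
        rw [withDensity_apply _ hs, ofReal_integral_eq_lintegral_ofReal hri.restrict
          (ae_of_all _ hr)]; rfl
    rw [Measure.add_apply, Measure.add_apply, h1 p hp0 hpi, h1 q hq0 hqi,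
      ← ofReal_measureReal (μ := m₁), ← ofReal_measureReal (μ := m₂),
      ← ENNReal.ofReal_add measureReal_nonneg (integral_nonneg hq0),
      ← ENNReal.ofReal_add measureReal_nonneg (integral_nonneg hp0)]
    congr 1
    have h2 := h s hs
    simp only [hpq] at h2
    rw [integral_sub hpi.restrict hqi.restrict] at h2
    linarith
  have e1 : ∀ r : ℝ → ℝ, Measurable r → (∀ y, 0 ≤ r y) → Integrable (fun y => r y * ψ y) m →
      Integrable ψ (m.withDensity (fun y => (r y).toNNReal)) ∧
      ∫ y, ψ y ∂(m.withDensity (fun y => (r y).toNNReal)) = ∫ y, r y * ψ y ∂m := by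
    intro r hrm hr hri
    have e : (fun y => (r y).toNNReal • ψ y) = fun y => r y * ψ y := by
      ext y; rw [NNReal.smul_def, Real.coe_toNNReal _ (hr y), smul_eq_mul]
    rw [integrable_withDensity_iff_integrable_smul hrm.real_toNNReal,
      integral_withDensity_eq_integral_smul hrm.real_toNNReal, e]
    exact ⟨hri, rfl⟩
  obtain ⟨ip, vp⟩ := e1 p hpm hp0 hpψ
  obtain ⟨iq, vq⟩ := e1 q hqm hq0 hqψ
  have hI : ∫ y, ψ y ∂(m₁ + m.withDensity (fun y => (q y).toNNReal))
      = ∫ y, ψ y ∂(m₂ + m.withDensity (fun y => (p y).toNNReal)) := by rw [key]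
  rw [integral_add_measure h₁ iq, integral_add_measure h₂ ip, vp, vq] at hI
  have h3 : ∫ y, φ y * ψ y ∂m = ∫ y, p y * ψ y ∂m - ∫ y, q y * ψ y ∂m := by
    rw [← integral_sub hpψ hqψ]
    exact integral_congr_ae (ae_of_all _ fun y => by simp only [hpq]; ring)
  linarith

/-! ### The resolvent set of a self-adjoint operator -/

section SelfAdjoint

variable {H : Type u} [NormedAddCommGroup H] [InnerProductSpace ℂ H]

/-- The basic lower bound for `L - z` with `L` symmetric. -/
theorem abs_im_mul_norm_le {L : H →ₗ.[ℂ] H} (hL : L.IsFormalAdjoint L) (z : ℂ) (v : L.domain) :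
    |z.im| * ‖(v : H)‖ ≤ ‖L v - z • (v : H)‖ := by
  have hreal : (inner ℂ (v : H) (L v)).im = 0 := by
    apply Complex.conj_eq_iff_im.1
    rw [inner_conj_symm, hL v v]
  have h1 : (inner ℂ (v : H) (L v - z • (v : H))).im = -(z.im * ‖(v : H)‖ ^ 2) := by
    rw [inner_sub_right, inner_smul_right, inner_self_eq_norm_sq_to_K, Complex.sub_im, hreal]
    simp [← Complex.ofReal_pow]
  have h2 : |z.im| * ‖(v : H)‖ ^ 2 ≤ ‖(v : H)‖ * ‖L v - z • (v : H)‖ := by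
    have h3 := (Complex.abs_im_le_norm _).trans
      (norm_inner_le_norm (𝕜 := ℂ) (v : H) (L v - z • (v : H)))
    rwa [h1, abs_neg, abs_mul, abs_of_nonneg (sq_nonneg ‖(v : H)‖)] at h3
  rcases (norm_nonneg (v : H)).eq_or_lt with h0 | h0
  · rw [← h0, mul_zero]; exact norm_nonneg _
  · exact le_of_mul_le_mul_left (by linarith) h0

/-- The map `L - z` on the domain of `L`. -/
noncomputable def subSMul (L : H →ₗ.[ℂ] H) (z : ℂ) : L.domain →ₗ[ℂ] H :=
  L.toFun - z • L.domain.subtype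

theorem subSMul_apply (L : H →ₗ.[ℂ] H) (z : ℂ) (v : L.domain) :
    subSMul L z v = L v - z • (v : H) := rfl

variable [CompleteSpace H]

theorem isFormalAdjoint_self {L : H →ₗ.[ℂ] H} (hL : IsSelfAdjoint L) : L.IsFormalAdjoint L := by
  have := LinearPMap.adjoint_isFormalAdjoint hL.dense_domain
  rwa [LinearPMap.isSelfAdjoint_def.1 hL] at this

/-- `L - z` has closed range: precomposed with the first projection of the graph of `L`, a complete
space, it is antilipschitz. -/
theorem isClosed_range_subSMul {L : H →ₗ.[ℂ] H} (hL : IsSelfAdjoint L) {z : ℂ} (hz : z.im ≠ 0) :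
    IsClosed ((subSMul L z).range : Set H) := by
  have hc : IsClosed (L.graph : Set (H × H)) := hL.isClosed
  have : CompleteSpace L.graph := hc.completeSpace_coe
  set T : L.graph →L[ℂ] H := (ContinuousLinearMap.snd ℂ H H - z • ContinuousLinearMap.fst ℂ H H) ∘L
    L.graph.subtypeL with hT
  have hgr : ∀ p : L.graph, ∃ v : L.domain, (v : H) = p.1.1 ∧ L v = p.1.2 := fun p => by
    obtain ⟨v, h1, h2⟩ := (LinearPMap.mem_graph_iff L).1 p.2
    exact ⟨v, h1, h2⟩
  have hz' : 0 < |z.im| := abs_pos.2 hz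
  have hanti : AntilipschitzWith (Real.toNNReal (|z.im|⁻¹ + 1 + ‖z‖ * |z.im|⁻¹)) T := by
    refine AddMonoidHomClass.antilipschitz_of_bound T fun p => ?_
    obtain ⟨v, h1, h2⟩ := hgr p
    have hTp : T p = L v - z • (v : H) := by rw [h1, h2]; rfl
    rw [Real.coe_toNNReal _ (by positivity), hTp]
    have hb := abs_im_mul_norm_le (isFormalAdjoint_self hL) z v
    have hv : ‖(v : H)‖ ≤ |z.im|⁻¹ * ‖L v - z • (v : H)‖ := by
      rwa [inv_mul_eq_div, le_div_iff₀' hz']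
    have hLv : ‖L v‖ ≤ ‖L v - z • (v : H)‖ + ‖z‖ * (|z.im|⁻¹ * ‖L v - z • (v : H)‖) := by
      calc ‖L v‖ = ‖(L v - z • (v : H)) + z • (v : H)‖ := by rw [sub_add_cancel]
        _ ≤ ‖L v - z • (v : H)‖ + ‖z‖ * ‖(v : H)‖ := by
          rw [← norm_smul]; exact norm_add_le _ _
        _ ≤ _ := by gcongr
    have hp : ‖p‖ = max ‖(v : H)‖ ‖L v‖ := by rw [h1, h2]; rfl
    have hn := norm_nonneg (L v - z • (v : H))
    have hi : 0 ≤ |z.im|⁻¹ := by positivity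
    rw [hp]
    refine max_le (hv.trans ?_) (hLv.trans ?_)
    · gcongr
      have := mul_nonneg (norm_nonneg z) hi
      linarith
    · nlinarith [mul_nonneg hi hn]
  have hcl := hanti.isClosed_range T.uniformContinuous
  convert hcl using 1
  ext w
  constructor
  · rintro ⟨v, rfl⟩
    exact ⟨⟨(v, L v), L.mem_graph v⟩, rfl⟩
  · rintro ⟨p, rfl⟩
    obtain ⟨v, h1, h2⟩ := hgr p
    exact ⟨v, by rw [subSMul_apply, h1, h2]; rfl⟩

/-- A vector orthogonal to the range of `L - z` is an eigenvector of `L` for the nonreal number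
`conj z`, hence zero. -/
theorem range_subSMul_eq_top {L : H →ₗ.[ℂ] H} (hL : IsSelfAdjoint L) {z : ℂ} (hz : z.im ≠ 0) :
    (subSMul L z).range = ⊤ := by
  have hcl := isClosed_range_subSMul hL hz
  have : CompleteSpace (subSMul L z).range := hcl.completeSpace_coe
  rw [← Submodule.orthogonal_eq_bot_iff, Submodule.eq_bot_iff]
  intro u hu
  have h0 : ∀ v : L.domain, inner ℂ (L v - z • (v : H)) u = 0 := fun v =>
    (Submodule.mem_orthogonal _ _).1 hu _ ⟨v, rfl⟩
  have h1 : ∀ v : L.domain, inner ℂ (starRingEnd ℂ z • u) (v : H) = inner ℂ u (L v) := fun v => by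
    have := congrArg (starRingEnd ℂ) (h0 v)
    rw [inner_conj_symm, inner_sub_right, inner_smul_right, map_zero, sub_eq_zero] at this
    rw [inner_smul_left, RingHomCompTriple.comp_apply, RingHom.id_apply, this]
  have hmem : u ∈ L.domain := by
    have := LinearPMap.mem_adjoint_domain_of_exists (T := L) u ⟨_, h1⟩
    rwa [LinearPMap.isSelfAdjoint_def.1 hL] at this
  have hLu : L ⟨u, hmem⟩ = starRingEnd ℂ z • u := by
    refine hL.dense_domain.eq_of_inner_left ℂ fun v hv => ?_
    rw [isFormalAdjoint_self hL ⟨u, hmem⟩ ⟨v, hv⟩, h1 ⟨v, hv⟩]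
  have hb := abs_im_mul_norm_le (isFormalAdjoint_self hL) (starRingEnd ℂ z) ⟨u, hmem⟩
  rw [hLu, sub_self, norm_zero, Complex.conj_im, abs_neg] at hb
  have hz' : 0 < |z.im| := abs_pos.2 hz
  exact norm_le_zero_iff.1 (nonpos_of_mul_nonpos_right hb hz')

theorem mem_resolventSet_of_im_ne_zero {L : H →ₗ.[ℂ] H} (hL : IsSelfAdjoint L) {z : ℂ}
    (hz : z.im ≠ 0) : z ∈ resolventSet L := by
  have hz' : 0 < |z.im| := abs_pos.2 hz
  have hb := fun v => abs_im_mul_norm_le (isFormalAdjoint_self hL) z v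
  have hinj : Function.Injective (subSMul L z) := by
    refine (injective_iff_map_eq_zero _).2 fun v hv => ?_
    have := hb v
    rw [← subSMul_apply, hv, norm_zero] at this
    exact Subtype.ext (norm_le_zero_iff.1 (nonpos_of_mul_nonpos_right this hz'))
  set e := LinearEquiv.ofBijective (subSMul L z)
    ⟨hinj, LinearMap.range_eq_top.1 (range_subSMul_eq_top hL hz)⟩ with he
  have hee : ∀ v : L.domain, e v = L v - z • (v : H) := fun v => rfl
  refine ⟨(L.domain.subtype ∘ₗ e.symm.toLinearMap).mkContinuous |z.im|⁻¹ fun g => ?_,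
    fun g => ⟨(e.symm g).2, ?_⟩, fun v => ?_⟩
  · have := hb (e.symm g)
    rw [← hee, e.apply_symm_apply] at this
    rw [inv_mul_eq_div, le_div_iff₀' hz']
    exact this
  · exact (hee _).symm.trans (e.apply_symm_apply g)
  · change ((e.symm (L v - z • (v : H)) : L.domain) : H) = v
    rw [← hee, e.symm_apply_apply]

end SelfAdjoint

section Spectral

variable {H : Type u} [NormedAddCommGroup H] [InnerProductSpace ℂ H] [CompleteSpace H]

/-! ### Scalar measures of a projection-valued measure -/

namespace ProjectionValuedMeasure

variable (E : ProjectionValuedMeasure H)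

theorem scalarMeasure_apply_eq_norm_sq (g : H) {s : Set ℝ} (hs : MeasurableSet s) :
    E.scalarMeasure g s = ENNReal.ofReal (‖E.proj s g‖ ^ 2) := by
  rw [E.scalarMeasure_apply g hs, E.inner_proj hs, Complex.ofReal_re]

instance isFiniteMeasure_scalarMeasure (g : H) : IsFiniteMeasure (E.scalarMeasure g) :=
  ⟨by rw [E.scalarMeasure_apply_eq_norm_sq g MeasurableSet.univ]; exact ENNReal.ofReal_lt_top⟩

theorem scalarMeasure_real (g : H) {s : Set ℝ} (hs : MeasurableSet s) :
    (E.scalarMeasure g).real s = ‖E.proj s g‖ ^ 2 := by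
  rw [Measure.real, E.scalarMeasure_apply_eq_norm_sq g hs, ENNReal.toReal_ofReal (by positivity)]

theorem scalarMeasure_univ (g : H) :
    E.scalarMeasure g Set.univ = ENNReal.ofReal (‖g‖ ^ 2) := by
  rw [E.scalarMeasure_apply_eq_norm_sq g MeasurableSet.univ, E.proj_univ]; rfl

theorem scalarMeasure_real_univ (g : H) : (E.scalarMeasure g).real Set.univ = ‖g‖ ^ 2 := by
  rw [E.scalarMeasure_real g MeasurableSet.univ, E.proj_univ]; rfl

theorem proj_proj {s t : Set ℝ} (hs : MeasurableSet s) (ht : MeasurableSet t) (g : H) :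
    E.proj s (E.proj t g) = E.proj (s ∩ t) g := by
  rw [E.proj_inter s t hs ht]; rfl

theorem inner_proj_left {s : Set ℝ} (hs : MeasurableSet s) (u v : H) :
    inner ℂ (E.proj s u) v = inner ℂ u (E.proj s v) := by
  have h2 : ContinuousLinearMap.adjoint (E.proj s) = E.proj s :=
    (E.isStarProjection s hs).isSelfAdjoint
  rw [← ContinuousLinearMap.adjoint_inner_right, h2]

theorem inner_proj_proj_eq_zero {s t : Set ℝ} (hs : MeasurableSet s) (ht : MeasurableSet t)
    (hst : Disjoint s t) (u v : H) : inner ℂ (E.proj s u) (E.proj t v) = 0 := by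
  rw [E.inner_proj_left hs, E.proj_proj hs ht, hst.inter_eq, E.proj_empty_apply, inner_zero_right]

/-- Finite additivity for a set and its complement. As `E(s) g` and `E(sᶜ) g` are orthogonal and
their squared norms add up to `‖g‖ ^ 2`, their sum is at distance `0` from `g`. -/
theorem proj_add_proj_compl {s : Set ℝ} (hs : MeasurableSet s) (g : H) :
    E.proj s g + E.proj sᶜ g = g := by
  have hm : (E.scalarMeasure g).real s + (E.scalarMeasure g).real sᶜ
      = (E.scalarMeasure g).real Set.univ := measureReal_add_measureReal_compl hs
  rw [E.scalarMeasure_real g hs, E.scalarMeasure_real g hs.compl, E.scalarMeasure_real_univ] at hm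
  have key : ‖g - (E.proj s g + E.proj sᶜ g)‖ ^ 2 = 0 := by
    have h1 : (inner ℂ g (E.proj s g)).re = ‖E.proj s g‖ ^ 2 := by
      rw [E.inner_proj hs, Complex.ofReal_re]
    have h2 : (inner ℂ g (E.proj sᶜ g)).re = ‖E.proj sᶜ g‖ ^ 2 := by
      rw [E.inner_proj hs.compl, Complex.ofReal_re]
    have h3 := E.inner_proj_proj_eq_zero hs hs.compl disjoint_compl_right g g
    have h4 := @norm_sub_sq ℂ H _ _ _ g (E.proj s g + E.proj sᶜ g)
    have h5 := @norm_add_sq ℂ H _ _ _ (E.proj s g) (E.proj sᶜ g)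
    rw [inner_add_right] at h4
    rw [h3] at h5
    simp only [map_add, RCLike.re_to_complex, h1, h2, map_zero] at h4 h5
    linarith
  have := norm_eq_zero.1 (pow_eq_zero_iff (two_ne_zero) |>.1 key)
  exact (sub_eq_zero.1 this).symm

theorem scalarMeasure_proj {s : Set ℝ} (hs : MeasurableSet s) (g : H) :
    E.scalarMeasure (E.proj s g) = (E.scalarMeasure g).restrict s := by
  ext t ht
  rw [Measure.restrict_apply ht, E.scalarMeasure_apply_eq_norm_sq _ ht,
    E.scalarMeasure_apply_eq_norm_sq _ (ht.inter hs), E.proj_proj ht hs]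

/-- Scalar measures add up for vectors living over disjoint sets. -/
theorem scalarMeasure_add_of_disjoint {s t : Set ℝ} (hs : MeasurableSet s) (ht : MeasurableSet t)
    (hst : Disjoint s t) (u v : H) :
    E.scalarMeasure (E.proj s u + E.proj t v)
      = E.scalarMeasure (E.proj s u) + E.scalarMeasure (E.proj t v) := by
  ext r hr
  rw [Measure.add_apply, E.scalarMeasure_apply_eq_norm_sq _ hr,
    E.scalarMeasure_apply_eq_norm_sq _ hr, E.scalarMeasure_apply_eq_norm_sq _ hr,
    ← ENNReal.ofReal_add (by positivity) (by positivity), map_add]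
  congr 1
  have h5 := @norm_add_sq ℂ H _ _ _ (E.proj r (E.proj s u)) (E.proj r (E.proj t v))
  rw [E.proj_proj hr hs, E.proj_proj hr ht, E.inner_proj_proj_eq_zero (hr.inter hs) (hr.inter ht)
    (hst.mono Set.inter_subset_right Set.inter_subset_right)] at h5
  rw [E.proj_proj hr hs, E.proj_proj hr ht, h5]
  simp

/-- Polarization of the scalar measures. -/
theorem scalarMeasure_real_add_sub {s : Set ℝ} (hs : MeasurableSet s) (u v : H) :
    (E.scalarMeasure (u + v)).real s - (E.scalarMeasure (u - v)).real s
      = 4 * (inner ℂ (E.proj s u) (E.proj s v)).re := by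
  rw [E.scalarMeasure_real _ hs, E.scalarMeasure_real _ hs, map_add, map_sub,
    @norm_add_sq ℂ H, @norm_sub_sq ℂ H]
  simp only [RCLike.re_to_complex]
  ring

end ProjectionValuedMeasure

/-! ### The scalar spectral measures of an operator and its resolvent -/

namespace ProjectionValuedMeasure.IsSpectralMeasureOf

variable {E : ProjectionValuedMeasure H} {L : H →ₗ.[ℂ] H}

theorem integrable_id (hE : E.IsSpectralMeasureOf L) (v : L.domain) :
    Integrable (fun y : ℝ => y) (E.scalarMeasure (v : H)) := by
  have h2 := (hE.1 v).1 v.2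
  refine ((integrable_const (1 : ℝ)).add h2).mono measurable_id.aestronglyMeasurable
    (ae_of_all _ fun y => ?_)
  simp only [Pi.add_apply, Real.norm_eq_abs]
  rw [abs_of_nonneg (by positivity : 0 ≤ 1 + y ^ 2)]
  nlinarith [sq_nonneg (|y| - 1), sq_abs y, abs_nonneg y]

theorem proj_mem_domain (hE : E.IsSpectralMeasureOf L) {s : Set ℝ} (hs : MeasurableSet s) {v : H}
    (hv : v ∈ L.domain) : E.proj s v ∈ L.domain := by
  rw [hE.1, E.scalarMeasure_proj hs]
  exact ((hE.1 v).1 hv).restrict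

/-- The range of the projection onto a bounded set lies in the domain. -/
theorem mem_domain_of_proj_eq (hE : E.IsSpectralMeasureOf L) {r : ℝ} {v : H}
    (hv : E.proj (Set.Icc (-r) r) v = v) : v ∈ L.domain := by
  rw [hE.1, ← hv, E.scalarMeasure_proj measurableSet_Icc]
  exact (continuous_pow 2).continuousOn.integrableOn_compact isCompact_Icc

/-- First half of the polarization: the quadratic form of `L` is additive over disjoint sets. -/
theorem inner_add_inner_eq_zero (hE : E.IsSpectralMeasureOf L) {s t : Set ℝ}
    (hs : MeasurableSet s) (ht : MeasurableSet t) (hst : Disjoint s t) (u v a b : L.domain)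
    (ha : (a : H) = E.proj s u) (hb : (b : H) = E.proj t v) :
    inner ℂ (a : H) (L b) + inner ℂ (b : H) (L a) = 0 := by
  have h := hE.2 (a + b)
  have hμ : E.scalarMeasure ((a + b : L.domain) : H)
      = E.scalarMeasure (a : H) + E.scalarMeasure (b : H) := by
    rw [Submodule.coe_add, ha, hb, E.scalarMeasure_add_of_disjoint hs ht hst]
  rw [hμ, integral_add_measure (hE.integrable_id a) (hE.integrable_id b), Complex.ofReal_add,
    ← hE.2 a, ← hE.2 b, L.map_add, Submodule.coe_add, inner_add_left, inner_add_right,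
    inner_add_right] at h
  linear_combination h

/-- The sesquilinear form of `L` vanishes between vectors over disjoint sets: replacing `v` by
`i v` in the previous relation separates its two terms. -/
theorem inner_eq_zero_of_disjoint (hE : E.IsSpectralMeasureOf L) {s t : Set ℝ}
    (hs : MeasurableSet s) (ht : MeasurableSet t) (hst : Disjoint s t) (u v a b : L.domain)
    (ha : (a : H) = E.proj s u) (hb : (b : H) = E.proj t v) :
    inner ℂ (a : H) (L b) = 0 := by
  have h1 := hE.inner_add_inner_eq_zero hs ht hst u v a b ha hb
  have h2 := hE.inner_add_inner_eq_zero hs ht hst u (Complex.I • v) a (Complex.I • b) ha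
    (by rw [Submodule.coe_smul, Submodule.coe_smul, map_smul, hb])
  rw [L.map_smul, Submodule.coe_smul, inner_smul_left, inner_smul_right, Complex.conj_I] at h2
  have h3 : Complex.I * (inner ℂ (a : H) (L b) - inner ℂ (b : H) (L a)) = 0 := by
    linear_combination h2
  have h4 := (mul_eq_zero.1 h3).resolve_left Complex.I_ne_zero
  linear_combination (h1 + h4) / 2

theorem proj_map_proj_eq_zero (hE : E.IsSpectralMeasureOf L) (hd : Dense (L.domain : Set H))
    {s t : Set ℝ} (hs : MeasurableSet s) (ht : MeasurableSet t) (hst : Disjoint s t)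
    (v b : L.domain) (hb : (b : H) = E.proj t v) : E.proj s (L b) = 0 := by
  refine hd.eq_zero_of_inner_right ℂ fun u hu => ?_
  rw [← E.inner_proj_left hs]
  exact hE.inner_eq_zero_of_disjoint hs ht hst ⟨u, hu⟩ v
    ⟨E.proj s u, hE.proj_mem_domain hs hu⟩ b rfl hb

/-- The spectral projections commute with `L`. -/
theorem map_proj (hE : E.IsSpectralMeasureOf L) (hd : Dense (L.domain : Set H))
    {s : Set ℝ} (hs : MeasurableSet s) (v b : L.domain) (hb : (b : H) = E.proj s v) :
    L b = E.proj s (L v) := by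
  set c : L.domain := ⟨E.proj sᶜ v, hE.proj_mem_domain hs.compl v.2⟩ with hc
  have hv : v = b + c := by
    ext; rw [Submodule.coe_add, hb, hc, E.proj_add_proj_compl hs]
  have h1 := hE.proj_map_proj_eq_zero hd hs hs.compl disjoint_compl_right v c rfl
  have h2 := hE.proj_map_proj_eq_zero hd hs.compl hs disjoint_compl_left v b hb
  have h3 := E.proj_add_proj_compl hs (L b)
  rw [h2, add_zero] at h3
  rw [hv, L.map_add, map_add, h1, add_zero, h3]

theorem inner_map_sub (hE : E.IsSpectralMeasureOf L) (x : ℝ) (v : L.domain) :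
    inner ℂ (v : H) (L v - (x : ℂ) • (v : H))
      = ((∫ y, (y - x) ∂(E.scalarMeasure (v : H)) : ℝ) : ℂ) := by
  rw [inner_sub_right, hE.2 v, inner_smul_right, inner_self_eq_norm_sq_to_K,
    integral_sub (hE.integrable_id v) (integrable_const _), integral_const,
    E.scalarMeasure_real_univ]
  simp [mul_comm]

/-- For `w` over a bounded set, `(L - x) w` has squared norm `∫ (y - x)² d⟨E(y) w, w⟩`. Here
`(L - x) w` is again in the domain, and four times its squared norm is the difference of the values
of the quadratic form of `L - x` at `w + (L - x) w` and `w - (L - x) w`. The scalar measures of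
these two vectors differ by `4 (y - x)` times that of `w`. -/
theorem norm_map_sub_sq_of_bounded (hE : E.IsSpectralMeasureOf L) (hL : IsSelfAdjoint L) (x r : ℝ)
    (w : L.domain) (hw : E.proj (Set.Icc (-r) r) w = w) :
    ‖L w - (x : ℂ) • (w : H)‖ ^ 2 = ∫ y, (y - x) ^ 2 ∂(E.scalarMeasure (w : H)) := by
  have hd := hL.dense_domain
  set B := Set.Icc (-r) r with hB
  have hcomm : ∀ s, MeasurableSet s → ∀ b : L.domain, (b : H) = E.proj s w →
      L b - (x : ℂ) • (b : H) = E.proj s (L w - (x : ℂ) • (w : H)) := fun s hs b hb => by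
    rw [hE.map_proj hd hs w b hb, hb, map_sub, map_smul]
  set u' := L w - (x : ℂ) • (w : H) with hu'
  have hu : E.proj B u' = u' := (hcomm B measurableSet_Icc w hw.symm).symm
  set u : L.domain := ⟨u', hE.mem_domain_of_proj_eq hu⟩ with hudef
  have hwL : inner ℂ (w : H) (L u - (x : ℂ) • (u : H)) = ((‖u'‖ ^ 2 : ℝ) : ℂ) := by
    have h1 : inner ℂ (w : H) (L u - (x : ℂ) • (u : H)) = inner ℂ u' u' := by
      rw [inner_sub_right, ← isFormalAdjoint_self hL w u, hu', inner_sub_left, inner_smul_left,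
        inner_smul_right]
      simp [hudef, hu']
    rw [h1, inner_self_eq_norm_sq_to_K]; norm_cast
  have hint : ∀ v : L.domain, Integrable (fun y : ℝ => y - x) (E.scalarMeasure (v : H)) :=
    fun v => (hE.integrable_id v).sub (integrable_const x)
  have huu : inner ℂ (u : H) (L w - (x : ℂ) • (w : H)) = ((‖u'‖ ^ 2 : ℝ) : ℂ) := by
    change inner ℂ u' u' = _
    rw [inner_self_eq_norm_sq_to_K]; norm_cast
  have hadd : ((∫ y, (y - x) ∂(E.scalarMeasure ((w : H) + u')) : ℝ) : ℂ)
      - ((∫ y, (y - x) ∂(E.scalarMeasure ((w : H) - u')) : ℝ) : ℂ) = ((4 * ‖u'‖ ^ 2 : ℝ) : ℂ) := by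
    have hp := hE.inner_map_sub x (w + u)
    have hm := hE.inner_map_sub x (w - u)
    have e1 : ((w + u : L.domain) : H) = (w : H) + u' := rfl
    have e2 : ((w - u : L.domain) : H) = (w : H) - u' := rfl
    rw [e1] at hp
    rw [e2] at hm
    rw [← hp, ← hm, L.map_add, L.map_sub]
    have f1 : L w + L u - (x : ℂ) • ((w : H) + u')
        = (L w - (x : ℂ) • (w : H)) + (L u - (x : ℂ) • (u : H)) := by
      rw [smul_add]; change _ = L w - (x : ℂ) • (w : H) + (L u - (x : ℂ) • u'); abel
    have f2 : L w - L u - (x : ℂ) • ((w : H) - u')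
        = (L w - (x : ℂ) • (w : H)) - (L u - (x : ℂ) • (u : H)) := by
      rw [smul_sub]; change _ = L w - (x : ℂ) • (w : H) - (L u - (x : ℂ) • u'); abel
    rw [f1, f2]
    simp only [inner_add_left, inner_add_right, inner_sub_left, inner_sub_right] at *
    push_cast at *
    linear_combination 2 * hwL + 2 * huu
  have hadd' : ∫ y, (y - x) ∂(E.scalarMeasure ((w : H) + u'))
      - ∫ y, (y - x) ∂(E.scalarMeasure ((w : H) - u')) = 4 * ‖u'‖ ^ 2 := by
    exact_mod_cast hadd
  have hset : ∀ s, MeasurableSet s → (E.scalarMeasure ((w : H) + u')).real s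
      - (E.scalarMeasure ((w : H) - u')).real s
      = ∫ y in s, 4 * (y - x) ∂(E.scalarMeasure (w : H)) := fun s hs => by
    set b : L.domain := ⟨E.proj s w, hE.proj_mem_domain hs w.2⟩
    have hb := hE.inner_map_sub x b
    rw [hcomm s hs b rfl, E.scalarMeasure_proj hs] at hb
    rw [E.scalarMeasure_real_add_sub hs, integral_const_mul]
    change inner ℂ (E.proj s w) (E.proj s u') = _ at hb
    rw [hb, Complex.ofReal_re]
  have hsq : Integrable (fun y : ℝ => 4 * (y - x) * (y - x)) (E.scalarMeasure (w : H)) := by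
    rw [← hw, E.scalarMeasure_proj measurableSet_Icc]
    exact (by fun_prop : Continuous fun y : ℝ => 4 * (y - x) * (y - x)).continuousOn
      |>.integrableOn_compact isCompact_Icc
  have hfin := integral_sub_integral_of_forall_setIntegral (by fun_prop)
    (by fun_prop) ((hint w).const_mul 4) hset (hint (w + u)) (hint (w - u)) hsq
  rw [hadd'] at hfin
  have : ∀ y : ℝ, 4 * (y - x) * (y - x) = 4 * (y - x) ^ 2 := fun y => by ring
  simp only [this, integral_const_mul] at hfin
  linarith

/-- For `w` in the domain, `s ↦ ‖E(s)(L - x) w‖²` has density `(y - x)²` with respect to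
`s ↦ ‖E(s) w‖²`. -/
theorem scalarMeasure_map_sub (hE : E.IsSpectralMeasureOf L) (hL : IsSelfAdjoint L) (x : ℝ)
    (w : L.domain) :
    E.scalarMeasure (L w - (x : ℂ) • (w : H))
      = (E.scalarMeasure (w : H)).withDensity (fun y => ENNReal.ofReal ((y - x) ^ 2)) := by
  have hd := hL.dense_domain
  -- both measures agree on bounded sets, hence on increasing unions of such sets
  have hB : ∀ n : ℕ, ∀ s, MeasurableSet s →
      E.scalarMeasure (L w - (x : ℂ) • (w : H)) (s ∩ Set.Icc (-(n : ℝ)) n)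
      = (E.scalarMeasure (w : H)).withDensity (fun y => ENNReal.ofReal ((y - x) ^ 2))
          (s ∩ Set.Icc (-(n : ℝ)) n) := by
    intro n s hs
    have ht : MeasurableSet (s ∩ Set.Icc (-(n : ℝ)) n) := hs.inter measurableSet_Icc
    set b : L.domain := ⟨E.proj (s ∩ Set.Icc (-(n : ℝ)) n) w, hE.proj_mem_domain ht w.2⟩ with hbd
    have hb := hE.norm_map_sub_sq_of_bounded hL x n b (by
      rw [hbd, E.proj_proj measurableSet_Icc ht]
      congr 2
      exact Set.inter_eq_right.2 Set.inter_subset_right)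
    rw [E.scalarMeasure_apply_eq_norm_sq _ ht, map_sub, map_smul, ← hE.map_proj hd ht w b rfl]
    change ENNReal.ofReal (‖L b - (x : ℂ) • (b : H)‖ ^ 2) = _
    rw [hb, withDensity_apply _ ht, hbd, E.scalarMeasure_proj ht,
      ofReal_integral_eq_lintegral_ofReal]
    · exact ((by fun_prop : Continuous fun y : ℝ => (y - x) ^ 2).continuousOn.integrableOn_compact
        isCompact_Icc).mono_set Set.inter_subset_right
    · exact ae_of_all _ fun y => sq_nonneg _
  ext s hs
  have hU : s = ⋃ n : ℕ, s ∩ Set.Icc (-(n : ℝ)) n := by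
    ext y
    simp only [Set.mem_iUnion, Set.mem_inter_iff, Set.mem_Icc, exists_and_left]
    refine ⟨fun h => ⟨h, ?_⟩, fun h => h.1⟩
    obtain ⟨n, hn⟩ := exists_nat_ge |y|
    exact ⟨n, abs_le.1 hn⟩
  have hmono : Monotone fun n : ℕ => s ∩ Set.Icc (-(n : ℝ)) n := fun m n hmn =>
    Set.inter_subset_inter_right _ (Set.Icc_subset_Icc (neg_le_neg (by exact_mod_cast hmn))
      (by exact_mod_cast hmn))
  rw [hU, hmono.measure_iUnion, hmono.measure_iUnion]
  exact iSup_congr fun n => hB n s hs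

/-- If `(L - x - iε) g = f`, then the scalar measure of `f` is `(y - x)² + ε²` times that of `g`. -/
theorem scalarMeasure_eq_withDensity (hE : E.IsSpectralMeasureOf L) (hL : IsSelfAdjoint L)
    (x ε : ℝ) (f : H) (g : L.domain)
    (hg : L g - ((x : ℂ) + (ε : ℂ) * Complex.I) • (g : H) = f) :
    E.scalarMeasure f = (E.scalarMeasure (g : H)).withDensity
      (fun y => ENNReal.ofReal ((y - x) ^ 2 + ε ^ 2)) := by
  have hsplit : (fun y : ℝ => ENNReal.ofReal ((y - x) ^ 2 + ε ^ 2))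
      = (fun y => ENNReal.ofReal ((y - x) ^ 2)) + fun _ => ENNReal.ofReal (ε ^ 2) := by
    ext y; exact ENNReal.ofReal_add (sq_nonneg _) (sq_nonneg _)
  rw [hsplit, withDensity_add_left (by fun_prop), ← hE.scalarMeasure_map_sub hL x g,
    withDensity_const]
  ext s hs
  rw [Measure.add_apply, Measure.smul_apply, E.scalarMeasure_apply_eq_norm_sq _ hs,
    E.scalarMeasure_apply_eq_norm_sq _ hs, E.scalarMeasure_apply_eq_norm_sq _ hs, smul_eq_mul,
    ← ENNReal.ofReal_mul (sq_nonneg _), ← ENNReal.ofReal_add (sq_nonneg _) (by positivity)]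
  congr 1
  set b : L.domain := ⟨E.proj s g, hE.proj_mem_domain hs g.2⟩
  have hb : E.proj s (L g - (x : ℂ) • (g : H)) = L b - (x : ℂ) • (b : H) := by
    rw [map_sub, map_smul, hE.map_proj hL.dense_domain hs g b rfl]
  have hf : E.proj s f = E.proj s (L g - (x : ℂ) • (g : H))
      - ((ε : ℂ) * Complex.I) • E.proj s g := by
    rw [← hg, ← map_smul, ← map_sub, add_smul, sub_sub]
  -- the cross term vanishes because the quadratic form of `L - x` is real
  have him : (inner ℂ (L b - (x : ℂ) • (b : H)) (((ε : ℂ) * Complex.I) • (b : H))).re = 0 := by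
    rw [inner_smul_right, ← inner_conj_symm, hE.inner_map_sub x b]
    simp
  rw [hf, hb, @norm_sub_sq ℂ H]
  change _ - 2 * (inner ℂ (L b - (x : ℂ) • (b : H)) (((ε : ℂ) * Complex.I) • (b : H))).re
    + ‖((ε : ℂ) * Complex.I) • (b : H)‖ ^ 2 = _ + ε ^ 2 * ‖(b : H)‖ ^ 2
  rw [him, norm_smul]
  simp [mul_pow]

/-- Smoothing the spectral measure is convolution with the Poisson kernel. For
`g = (L - x - iε)⁻¹ f` the left side is `π⁻¹ ε ‖g‖ ^ 2`, and `‖g‖ ^ 2` is the total mass of the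
scalar measure of `g`, which is that of `f` divided by `(y - x)² + ε²`. -/
theorem smoothedMeasure_eq_integral (hE : E.IsSpectralMeasureOf L) (hL : IsSelfAdjoint L)
    {x ε : ℝ} (hε : 0 < ε) (hz : (x : ℂ) + (ε : ℂ) * Complex.I ∈ resolventSet L) (f : H) :
    smoothedMeasure L f ε x
      = ∫ y, poissonKernel x ε y ∂(E.scalarMeasure f) := by
  obtain ⟨hg, hLg⟩ := (isResolventAt_resolvent hz).1 f
  set g : L.domain := ⟨resolvent L ((x : ℂ) + (ε : ℂ) * Complex.I) f, hg⟩ with hgd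
  have him : (inner ℂ f (g : H)).im = ε * ‖(g : H)‖ ^ 2 := by
    have h1 : f = (L g - (x : ℂ) • (g : H)) - ((ε : ℂ) * Complex.I) • (g : H) := by
      rw [sub_sub, ← add_smul]; exact hLg.symm
    rw [h1, inner_sub_left, ← inner_conj_symm, hE.inner_map_sub x g, inner_smul_left,
      inner_self_eq_norm_sq_to_K]
    simp [← Complex.ofReal_pow]
  have hpos : ∀ y : ℝ, 0 < (y - x) ^ 2 + ε ^ 2 := fun y => by positivity
  rw [smoothedMeasure]
  change 1 / Real.pi * (inner ℂ f (g : H)).im = _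
  rw [him, hE.scalarMeasure_eq_withDensity hL x ε f g hLg,
    integral_withDensity_eq_integral_toReal_smul (by fun_prop)
      (ae_of_all _ fun _ => ENNReal.ofReal_lt_top), ← E.scalarMeasure_real_univ]
  have : ∀ y : ℝ, (ENNReal.ofReal ((y - x) ^ 2 + ε ^ 2)).toReal •
      poissonKernel x ε y = Real.pi⁻¹ * ε := fun y => by
    rw [ENNReal.toReal_ofReal (hpos y).le, smul_eq_mul, poissonKernel]
    field_simp [(hpos y).ne']
  simp only [this, integral_const, smul_eq_mul]
  ring

end ProjectionValuedMeasure.IsSpectralMeasureOf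

end Spectral

end SpectralPoisson

theorem mainTheorem1 :
    ∃ C : ℝ, 0 ≤ C ∧
      ∀ (H : Type u) [NormedAddCommGroup H] [InnerProductSpace ℂ H] [CompleteSpace H]
        (L : H →ₗ.[ℂ] H) (_hL : IsSelfAdjoint L)
        (E : SpectralPoisson.ProjectionValuedMeasure H) (_hE : E.IsSpectralMeasureOf L)
        (f : H) (_hf : ‖f‖ = 1)
        (ρ : ℝ → ℝ)
        (_hρ : ρ =ᵐ[volume] fun y => ((E.scalarMeasure f).rnDeriv volume y).toReal)
        (x₀ η α : ℝ) (_hη : 0 < η) (_hα₀ : 0 ≤ α) (_hα₁ : α < 1)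
        (_hac : (E.scalarMeasure f).restrict (Set.Ioo (x₀ - η) (x₀ + η)) ≪ volume)
        (_hρα : SpectralPoisson.MemHolder α (Set.Ioo (x₀ - η) (x₀ + η)) ρ),
        (∀ ε : ℝ, 0 < ε →
          (x₀ : ℂ) + (ε : ℂ) * Complex.I ∈ SpectralPoisson.resolventSet L) ∧
        ((fun ε : ℝ => |ρ x₀ - SpectralPoisson.smoothedMeasure L f ε x₀|)
          =O[𝓝[>] 0] fun ε : ℝ => ε ^ α) ∧
        ∀ ε : ℝ, 0 < ε →
          |ρ x₀ - SpectralPoisson.smoothedMeasure L f ε x₀| ≤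
            (SpectralPoisson.holderSeminorm α (Set.Ioo (x₀ - η) (x₀ + η)) ρ
                + C * η ^ (-α) * SpectralPoisson.supNorm (Set.Ioo (x₀ - η) (x₀ + η)) ρ)
              * (Real.cos (α * Real.pi / 2))⁻¹ * ε ^ α
            + ε / (Real.pi * (ε ^ 2 + η ^ 2 / 4)) := by
  refine ⟨2, two_pos.le, ?_⟩
  intro H _ _ _ L hL E hE f hf ρ hρ x₀ η α hη hα₀ hα₁ hac hρα
  have hz : ∀ ε : ℝ, 0 < ε →
      (x₀ : ℂ) + (ε : ℂ) * Complex.I ∈ SpectralPoisson.resolventSet L := fun ε hε =>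
    SpectralPoisson.mem_resolventSet_of_im_ne_zero hL (by simpa using hε.ne')
  have hprob : IsProbabilityMeasure (E.scalarMeasure f) :=
    ⟨by rw [E.scalarMeasure_univ, hf]; simp⟩
  have hbound : ∀ ε : ℝ, 0 < ε → |ρ x₀ - SpectralPoisson.smoothedMeasure L f ε x₀| ≤
      (SpectralPoisson.holderSeminorm α (Set.Ioo (x₀ - η) (x₀ + η)) ρ
          + 2 * η ^ (-α) * SpectralPoisson.supNorm (Set.Ioo (x₀ - η) (x₀ + η)) ρ)
        * (Real.cos (α * Real.pi / 2))⁻¹ * ε ^ α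
      + ε / (Real.pi * (ε ^ 2 + η ^ 2 / 4)) := fun ε hε => by
    rw [hE.smoothedMeasure_eq_integral hL hε (hz ε hε)]
    exact SpectralPoisson.abs_sub_integral_poissonKernel_le hρ hη hα₀ hα₁ hac hρα hε
  refine ⟨hz, ?_, hbound⟩
  refine IsBigO.of_bound ((SpectralPoisson.holderSeminorm α (Set.Ioo (x₀ - η) (x₀ + η)) ρ
      + 2 * η ^ (-α) * SpectralPoisson.supNorm (Set.Ioo (x₀ - η) (x₀ + η)) ρ)
      * (Real.cos (α * Real.pi / 2))⁻¹ + (Real.pi * (η ^ 2 / 4))⁻¹) ?_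
  filter_upwards [Ioo_mem_nhdsGT (zero_lt_one' ℝ)] with ε hε
  obtain ⟨hε0, hε1⟩ := hε
  have hεα : ε ≤ ε ^ α := by
    calc ε = ε ^ (1 : ℝ) := (Real.rpow_one ε).symm
      _ ≤ ε ^ α := Real.rpow_le_rpow_of_exponent_ge hε0 hε1.le hα₁.le
  have hlast : ε / (Real.pi * (ε ^ 2 + η ^ 2 / 4)) ≤ (Real.pi * (η ^ 2 / 4))⁻¹ * ε ^ α := by
    rw [div_eq_inv_mul]
    gcongr
    nlinarith [sq_nonneg ε]
  rw [Real.norm_eq_abs, abs_abs, Real.norm_of_nonneg (Real.rpow_nonneg hε0.le α), add_mul]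
  exact (hbound ε hε0).trans (by gcongr)
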